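/- Let $\mathcal{X}$ be a semi-abelian category, that is, a category with a zero object and binary coproducts which is Barr-exact and Bourn-protomodular. For an object $Y$ of $\mathcal{X}$, let $\mathsf{Pt}_Y(\mathcal{X})$ be the category of points over $Y$, i.e. of split epimorphisms $p\colon A\to Y$ with a chosen section. In $\mathcal{X}$ and in each $\mathsf{Pt}_Y(\mathcal{X})$, call an object abelian if it carries an internal abelian group structure, and write $\mathrm{ab}$ for the reflection onto the full subcategory of abelian objects (abelianisation). Suppose that $\mathcal{X}$ is peri-abelian: for every morphism $f\colon X\to Y$ of $\mathcal{X}$, the change-of-base functor $f^{*}\colon \mathsf{Pt}_Y(\mathcal{X})\to\mathsf{Pt}_X(\mathcal{X})$, given by pulling back along $f$, commutes with abelianisation, i.e. it sends each unit $p\to\mathrm{ab}(p)$ to an abelianisation of $f^{*}(p)$. Call an object $P$ of $\mathcal{X}$ perfect if $\mathrm{ab}(P)=0$, and for objects $B$ and $P$ of $\mathcal{X}$ let $B\flat P$ be the kernel of the morphism $B+P\to B$ which is the identity on $B$ and zero on $P$. Then, for all objects $B$ and $P$ of $\mathcal{X}$: if $P$ is perfect, then $B\flat P$ is perfect. -/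

import Mathlib

open CategoryTheory CategoryTheory.Limits

universe v u

namespace PeriAbelian

/-- A point over `B`: a split epimorphism `proj` with codomain `B` and a chosen section `sect`. -/
structure Pt {C : Type u} [Category.{v} C] (B : C) where
  /-- the domain of the split epimorphism -/
  pt : C
  /-- the split epimorphism -/
  proj : pt ⟶ B
  /-- the chosen section -/
  sect : B ⟶ pt
  sect_proj : sect ≫ proj = 𝟙 B

namespace Pt

/-- A morphism of points over `B`. -/
@[ext]
structure Hom {C : Type u} [Category.{v} C] {B : C} (p q : Pt B) where
  /-- the underlying morphism -/
  hom : p.pt ⟶ q.pt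
  hom_proj : hom ≫ q.proj = p.proj
  sect_hom : p.sect ≫ hom = q.sect

/-- The category of points over `B`, i.e. the fibre over `B` of the fibration of points. -/
instance category {C : Type u} [Category.{v} C] (B : C) : Category (Pt B) where
  Hom p q := Hom p q
  id p := ⟨𝟙 p.pt, by simp, by simp⟩
  comp a b := ⟨a.hom ≫ b.hom, by simp [b.hom_proj, a.hom_proj],
    by simp [← Category.assoc, b.sect_hom, a.sect_hom]⟩
  id_comp a := Hom.ext (Category.id_comp a.hom)
  comp_id a := Hom.ext (Category.comp_id a.hom)
  assoc a b c := Hom.ext (Category.assoc a.hom b.hom c.hom)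

section

variable {C : Type u} [Category.{v} C] {B : C}

@[ext]
theorem hom_ext {p q : Pt B} {a b : p ⟶ q} (h : a.hom = b.hom) : a = b := Hom.ext h

@[simp]
theorem id_hom (p : Pt B) : Hom.hom (𝟙 p) = 𝟙 p.pt := rfl

@[simp]
theorem comp_hom {p q r : Pt B} (a : p ⟶ q) (b : q ⟶ r) : (a ≫ b).hom = a.hom ≫ b.hom := rfl

@[simp]
theorem hom_w_proj {p q : Pt B} (a : p ⟶ q) : a.hom ≫ q.proj = p.proj := a.hom_proj

@[simp]
theorem hom_w_proj_assoc {p q : Pt B} (a : p ⟶ q) {Z : C} (z : B ⟶ Z) :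
    a.hom ≫ q.proj ≫ z = p.proj ≫ z := by
  rw [← Category.assoc, hom_w_proj]

@[simp]
theorem sect_w_hom {p q : Pt B} (a : p ⟶ q) : p.sect ≫ a.hom = q.sect := a.sect_hom

attribute [simp] sect_proj

@[simp]
theorem sect_proj_assoc (p : Pt B) {Z : C} (z : B ⟶ Z) : p.sect ≫ p.proj ≫ z = z := by
  rw [← Category.assoc, sect_proj, Category.id_comp]

end

attribute [local simp] pullback.lift_fst pullback.lift_snd pullback.lift_fst_assoc
  pullback.lift_snd_assoc

/-- The change-of-base functor `f^* : Pt Y ⥤ Pt X`, given by pulling back along `f : X ⟶ Y`. -/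
noncomputable def changeOfBase {C : Type u} [Category.{v} C] [HasPullbacks C] {X Y : C}
    (f : X ⟶ Y) : Pt Y ⥤ Pt X where
  obj p :=
    { pt := pullback p.proj f
      proj := pullback.snd p.proj f
      sect := pullback.lift (f ≫ p.sect) (𝟙 X) (by simp)
      sect_proj := by simp }
  map {p q} a :=
    { hom := pullback.lift (pullback.fst p.proj f ≫ a.hom) (pullback.snd p.proj f)
        (by simp [pullback.condition])
      hom_proj := by simp
      sect_hom := by apply pullback.hom_ext <;> simp }
  map_id p := by
    apply hom_ext
    apply pullback.hom_ext <;> simp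
  map_comp a b := by
    apply hom_ext
    apply pullback.hom_ext <;> simp

/-- The identity point on `B`. -/
def idPt {C : Type u} [Category.{v} C] (B : C) : Pt B := ⟨B, 𝟙 B, 𝟙 B, by simp⟩

/-- The identity point is terminal in the category of points over `B`. -/
def idPtIsTerminal {C : Type u} [Category.{v} C] (B : C) : IsTerminal (idPt B) :=
  IsTerminal.ofUniqueHom (fun p => ⟨p.proj, by simp [idPt], by simp [idPt]⟩)
    (fun p m => hom_ext (by simpa [idPt] using m.hom_proj))

/-- The product of two points over `B`, given by the pullback over `B`. -/
noncomputable def prodPt {C : Type u} [Category.{v} C] [HasPullbacks C] {B : C} (p q : Pt B) :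
    Pt B where
  pt := pullback p.proj q.proj
  proj := pullback.fst p.proj q.proj ≫ p.proj
  sect := pullback.lift p.sect q.sect (by simp)
  sect_proj := by simp

/-- The first projection of the product of two points. -/
noncomputable def prodPtFst {C : Type u} [Category.{v} C] [HasPullbacks C] {B : C} (p q : Pt B) :
    prodPt p q ⟶ p :=
  ⟨pullback.fst p.proj q.proj, rfl, by simp [prodPt]⟩

/-- The second projection of the product of two points. -/
noncomputable def prodPtSnd {C : Type u} [Category.{v} C] [HasPullbacks C] {B : C} (p q : Pt B) :
    prodPt p q ⟶ q :=
  ⟨pullback.snd p.proj q.proj, pullback.condition.symm, by simp [prodPt]⟩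

/-- The morphism into the product of two points induced by a pair of morphisms. -/
noncomputable def prodPtLift {C : Type u} [Category.{v} C] [HasPullbacks C] {B : C} {p q r : Pt B}
    (a : r ⟶ p) (b : r ⟶ q) : r ⟶ prodPt p q :=
  ⟨pullback.lift a.hom b.hom (by simp), by simp [prodPt],
    by apply pullback.hom_ext <;> simp [prodPt]⟩

/-- The pullback over `B` is a product in the category of points over `B`. -/
noncomputable def prodPtIsLimit {C : Type u} [Category.{v} C] [HasPullbacks C] {B : C}
    (p q : Pt B) : IsLimit (BinaryFan.mk (prodPtFst p q) (prodPtSnd p q)) :=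
  BinaryFan.IsLimit.mk _ (fun a b => prodPtLift a b)
    (fun a b => hom_ext (pullback.lift_fst a.hom b.hom (by simp)))
    (fun a b => hom_ext (pullback.lift_snd a.hom b.hom (by simp)))
    (fun a b m h₁ h₂ => hom_ext (pullback.hom_ext
      ((congrArg Hom.hom h₁).trans (pullback.lift_fst a.hom b.hom (by simp)).symm)
      ((congrArg Hom.hom h₂).trans (pullback.lift_snd a.hom b.hom (by simp)).symm)))

instance hasFiniteProducts {C : Type u} [Category.{v} C] [HasPullbacks C] (B : C) :
    HasFiniteProducts (Pt B) := by
  have : HasTerminal (Pt B) := (idPtIsTerminal B).hasTerminal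
  have : HasBinaryProducts (Pt B) := by
    have : ∀ p q : Pt B, HasLimit (pair p q) := fun p q =>
      HasLimit.mk ⟨_, prodPtIsLimit p q⟩
    exact hasBinaryProducts_of_hasLimit_pair _
  exact hasFiniteProducts_of_has_binary_and_terminal

end Pt

/-- A semi-abelian category: a category with a zero object and binary coproducts which is
Barr-exact (regular, and every internal equivalence relation is a kernel pair) and
Bourn-protomodular (all change-of-base functors of the fibration of points reflect
isomorphisms). -/
class SemiAbelian (C : Type u) [Category.{v} C] : Prop extends
    Regular C, HasZeroObject C, HasBinaryCoproducts C where
  exact {R X : C} (r₁ r₂ : R ⟶ X) :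
    IsEquivalenceRelation r₁ r₂ → ∃ (Q : C) (q : X ⟶ Q), IsKernelPair q r₁ r₂
  protomodular {X Y : C} (f : X ⟶ Y) : (Pt.changeOfBase f).ReflectsIsomorphisms

/-- An object is abelian when it carries an internal abelian group structure, formed with respect
to the categorical products. (In a semi-abelian category, and in its categories of points, such a
structure is unique, and every morphism between abelian objects is a homomorphism, so that the
category of internal abelian groups is the full subcategory of abelian objects.) -/
def IsAbelianObject {D : Type u} [Category.{v} D] [HasFiniteProducts D] (A : D) : Prop :=
  letI : CartesianMonoidalCategory D := CartesianMonoidalCategory.ofHasFiniteProducts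
  letI : BraidedCategory D := BraidedCategory.ofCartesianMonoidalCategory
  ∃ _ : GrpObj A, IsCommMonObj A

/-- `η : X ⟶ A` exhibits `A` as the abelianisation `ab(X)` of `X`, i.e. as its reflection in the
full subcategory of abelian objects. -/
def IsAbelianisation {D : Type u} [Category.{v} D] [HasFiniteProducts D] {X A : D}
    (η : X ⟶ A) : Prop :=
  IsAbelianObject A ∧
    ∀ (A' : D), IsAbelianObject A' → ∀ g : X ⟶ A', ∃! h : A ⟶ A', η ≫ h = g

/-- An object is perfect when its abelianisation is zero. -/
def IsPerfect {D : Type u} [Category.{v} D] [HasFiniteProducts D] (P : D) : Prop :=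
  ∃ (A : D) (η : P ⟶ A), IsAbelianisation η ∧ IsZero A

/-- Condition (PA): every change-of-base functor `f^* : Pt Y ⥤ Pt X` commutes with
abelianisation, i.e. takes the unit `p ⟶ ab(p)` in `Pt Y` to an abelianisation of `f^*(p)` in
`Pt X`. -/
def IsPeriAbelian (C : Type u) [Category.{v} C] [HasPullbacks C] : Prop :=
  ∀ ⦃X Y : C⦄ (f : X ⟶ Y) (p A : Pt Y) (η : p ⟶ A),
    IsAbelianisation η → IsAbelianisation ((Pt.changeOfBase f).map η)

/-- The object `B ♭ P`: the kernel of the morphism `B + P ⟶ B` which is the identity on `B` and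
zero on `P`. -/
noncomputable def bemol {C : Type u} [Category.{v} C] [HasZeroMorphisms C] [HasFiniteLimits C]
    [HasBinaryCoproducts C] (B P : C) : C :=
  kernel (coprod.desc (𝟙 B) (0 : P ⟶ B))

end PeriAbelian

namespace PeriAbelian

/-! A morphism from the free point `B + P ⟶ B` to a point `A` over `B` is the same as a morphism
from `P` to the kernel of `A.proj`. If `A` is abelian, so is that kernel, because the kernel functor
is a right adjoint (`freeHomEquiv`); for perfect `P` there is then exactly one such morphism. Hence
the free point abelianises to the terminal point (`isAbelianisation_free`). Pulling back along `0 ⟶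
B` turns the free point into `B ♭ P` over zero and the terminal point into zero, and by
peri-abelianness the result is again an abelianisation. So every morphism from `B ♭ P` to an abelian
object factors through zero. -/

section Abelian

variable {D : Type*} [Category D] [HasFiniteProducts D]

/-- A terminal object is abelian. -/
theorem IsAbelianObject.of_isTerminal {A : D} (hA : IsTerminal A) : IsAbelianObject A := by
  let : CartesianMonoidalCategory D := CartesianMonoidalCategory.ofHasFiniteProducts
  let : BraidedCategory D := BraidedCategory.ofCartesianMonoidalCategory
  let hG : GrpObj A :=
    { one := hA.from _
      mul := hA.from _
      inv := hA.from _
      one_mul := hA.hom_ext _ _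
      mul_one := hA.hom_ext _ _
      mul_assoc := hA.hom_ext _ _
      left_inv := hA.hom_ext _ _
      right_inv := hA.hom_ext _ _ }
  exact ⟨hG, { mul_comm := hA.hom_ext _ _ }⟩

/-- Functors preserving finite products preserve abelian objects. -/
theorem IsAbelianObject.map {E : Type*} [Category E] [HasFiniteProducts E] (F : D ⥤ E)
    [PreservesFiniteProducts F] {A : D} (hA : IsAbelianObject A) : IsAbelianObject (F.obj A) := by
  let : CartesianMonoidalCategory D := CartesianMonoidalCategory.ofHasFiniteProducts
  let : BraidedCategory D := BraidedCategory.ofCartesianMonoidalCategory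
  let : CartesianMonoidalCategory E := CartesianMonoidalCategory.ofHasFiniteProducts
  let : BraidedCategory E := BraidedCategory.ofCartesianMonoidalCategory
  let : F.Monoidal := Functor.Monoidal.ofChosenFiniteProducts F
  let : F.Braided := Functor.Braided.ofChosenFiniteProducts F
  obtain ⟨hG, hC⟩ := hA
  exact ⟨Functor.grpObjObj, inferInstance⟩

/-- In a category with zero morphisms, an object is perfect as soon as all morphisms from it to
abelian objects vanish. -/
theorem IsPerfect.of_forall_eq_zero [HasZeroMorphisms D] [HasZeroObject D] {P : D}
    (h : ∀ A : D, IsAbelianObject A → ∀ g : P ⟶ A, g = 0) : IsPerfect P := by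
  obtain ⟨Z, hZ⟩ := HasZeroObject.zero (C := D)
  exact ⟨Z, 0, ⟨.of_isTerminal hZ.isTerminal, fun A hA g =>
    ⟨0, by simp [h A hA g], fun _ _ => hZ.eq_of_src _ _⟩⟩, hZ⟩

/-- All morphisms from a perfect object to an abelian object vanish. -/
theorem IsPerfect.eq_zero [HasZeroMorphisms D] {P A : D} (hP : IsPerfect P)
    (hA : IsAbelianObject A) (g : P ⟶ A) : g = 0 := by
  obtain ⟨Q, η, ⟨-, hη⟩, hQ⟩ := hP
  obtain ⟨h, rfl, -⟩ := hη A hA g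
  simp [hQ.eq_zero_of_src h]

end Abelian

namespace Pt

variable {C : Type u} [Category.{v} C] [HasZeroMorphisms C]

attribute [local simp] kernel.lift_ι kernel.lift_ι_assoc kernel.condition kernel.condition_assoc

section Free

variable [HasBinaryCoproducts C]

/-- The point `B + X ⟶ B` freely generated by an object `X`. -/
noncomputable def free (B X : C) : Pt B where
  pt := B ⨿ X
  proj := coprod.desc (𝟙 B) 0
  sect := coprod.inl
  sect_proj := coprod.inl_desc _ _

/-- The inclusion of generators into the free point on `X`. -/
noncomputable def freeInr (B X : C) : X ⟶ (free B X).pt := coprod.inr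

@[simp]
theorem freeInr_proj (B X : C) : freeInr B X ≫ (free B X).proj = 0 :=
  coprod.inr_desc _ _

@[simp]
theorem freeInr_hom_proj {B X : C} {p : Pt B} (a : free B X ⟶ p) :
    freeInr B X ≫ a.hom ≫ p.proj = 0 := by
  rw [hom_w_proj, freeInr_proj]

theorem free_hom_ext {B X : C} {p : Pt B} {a b : free B X ⟶ p}
    (h : freeInr B X ≫ a.hom = freeInr B X ≫ b.hom) : a = b :=
  hom_ext (coprod.hom_ext ((sect_w_hom a).trans (sect_w_hom b).symm) h)

/-- The morphism out of a free point induced by a morphism which the split epimorphism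
annihilates. -/
noncomputable def freeDesc {B X : C} {p : Pt B} (k : X ⟶ p.pt) (hk : k ≫ p.proj = 0) :
    free B X ⟶ p where
  hom := coprod.desc p.sect k
  hom_proj := by
    refine (coprod.desc_comp _ _ _).trans ?_
    rw [sect_proj, hk]
    rfl
  sect_hom := coprod.inl_desc _ _

@[simp]
theorem freeInr_freeDesc {B X : C} {p : Pt B} (k : X ⟶ p.pt) (hk : k ≫ p.proj = 0) :
    freeInr B X ≫ (freeDesc k hk).hom = k :=
  coprod.inr_desc _ _

variable [HasKernels C]

/-- The functor sending a point to the kernel of its split epimorphism. -/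
noncomputable def kernelFunctor (B : C) : Pt B ⥤ C where
  obj p := kernel p.proj
  map a := kernel.map _ _ a.hom (𝟙 B) (by simp)
  map_id p := by
    apply equalizer.hom_ext
    exact (kernel.lift_ι _ _ _).trans (by simp)
  map_comp a b := by
    apply equalizer.hom_ext
    exact (kernel.lift_ι _ _ _).trans (by simp)

/-- Morphisms out of the free point on `X` are morphisms from `X` to the kernel. -/
noncomputable def freeHomEquiv (B X : C) (p : Pt B) :
    (free B X ⟶ p) ≃ (X ⟶ kernel p.proj) where
  toFun a := kernel.lift p.proj (freeInr B X ≫ a.hom) (by simp)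
  invFun k := freeDesc (k ≫ kernel.ι p.proj) (by simp)
  left_inv a := free_hom_ext (by simp)
  right_inv k := by simp [← cancel_mono (kernel.ι p.proj)]

/-- Right adjoints preserve finite products, so kernels of abelian points are abelian. -/
instance (B : C) : (kernelFunctor B).IsRightAdjoint :=
  (Adjunction.adjunctionOfEquivLeft (G := kernelFunctor B) (fun X p => freeHomEquiv B X p) (by
    intro X p q g h
    refine (cancel_mono (kernel.ι q.proj)).1 ?_
    change kernel.lift _ _ _ ≫ _ = (kernel.lift _ _ _ ≫ kernel.map p.proj q.proj g.hom (𝟙 B) (by simp)) ≫ _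
    simp)).isRightAdjoint

/-- If `P` is perfect, then the morphism from the free point on `P` to the terminal point is an
abelianisation. -/
theorem isAbelianisation_free [HasFiniteProducts C] [HasPullbacks C] (B : C) {P : C}
    (hP : IsPerfect P) : IsAbelianisation ((idPtIsTerminal B).from (free B P)) := by
  refine ⟨.of_isTerminal (idPtIsTerminal B), fun A hA g => ?_⟩
  have huniq (a b : free B P ⟶ A) : a = b := by
    have hK := hA.map (kernelFunctor B)
    exact (freeHomEquiv B P A).injective ((hP.eq_zero hK _).trans (hP.eq_zero hK _).symm)
  -- Compatibility with sections forces any morphism from the terminal point to be the section of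
  -- `A`.
  refine ⟨⟨A.sect, by simp [idPt], by simp [idPt]⟩, huniq _ _, fun h _ => ?_⟩
  ext
  simpa [idPt] using sect_w_hom h

end Free

section Zero

variable {Z : C} (hZ : IsZero Z)

/-- Every object is the domain of a point over a zero object. -/
def ofObj : C ⥤ Pt Z where
  obj X := ⟨X, 0, 0, hZ.eq_of_src _ _⟩
  map f := ⟨f, by simp, by simp⟩

/-- Morphisms of points over a zero object are morphisms of their domains. -/
def homOfObjEquiv (p : Pt Z) (X : C) : (p.pt ⟶ X) ≃ (p ⟶ (ofObj hZ).obj X) where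
  toFun f := ⟨f, hZ.eq_of_tgt _ _, hZ.eq_of_src _ _⟩
  invFun a := a.hom
  left_inv _ := rfl
  right_inv _ := rfl

/-- As a right adjoint, `ofObj` carries abelian objects to abelian points over zero, against which
the pulled-back unit can be tested. -/
instance : (ofObj hZ).IsRightAdjoint :=
  (Adjunction.adjunctionOfEquivLeft (G := ofObj hZ) (fun p X => homOfObjEquiv hZ p X)
    (fun _ _ _ _ _ => rfl)).isRightAdjoint

end Zero

end Pt

/-- In a peri-abelian category, `B ♭ P` is perfect whenever `P` is. -/
theorem isPerfect_bemol {C : Type u} [Category.{v} C] [HasZeroMorphisms C] [HasZeroObject C]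
    [HasFiniteLimits C] [HasBinaryCoproducts C] (hPA : IsPeriAbelian C) (B : C) {P : C}
    (hP : IsPerfect P) : IsPerfect (bemol B P) := by
  refine .of_forall_eq_zero fun A hA g => ?_
  obtain ⟨Z, hZ⟩ := HasZeroObject.zero (C := C)
  let F := Pt.changeOfBase (0 : Z ⟶ B)
  let φ : (F.obj (Pt.free B P)).pt ⟶ bemol B P :=
    kernel.lift _ (pullback.fst (Pt.free B P).proj (0 : Z ⟶ B))
      (pullback.condition.trans comp_zero)
  let ψ : bemol B P ⟶ (F.obj (Pt.free B P)).pt :=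
    pullback.lift (kernel.ι _) 0 ((kernel.condition _).trans zero_comp.symm)
  -- It suffices that `B ♭ P` is a retract of the pullback: `g` vanishes as soon as `φ ≫ g` does.
  have hψφ : ψ ≫ φ = 𝟙 _ := by
    refine (cancel_mono (kernel.ι (coprod.desc (𝟙 B) (0 : P ⟶ B)))).1 ?_
    refine (Category.assoc _ _ _).trans (Eq.trans ?_ (Category.id_comp _).symm)
    exact (congrArg _ (kernel.lift_ι _ _ _)).trans (pullback.lift_fst _ _ _)
  obtain ⟨h, hh, -⟩ := (hPA (0 : Z ⟶ B) _ _ _ (Pt.isAbelianisation_free B hP)).2 _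
    (hA.map (Pt.ofObj hZ)) (Pt.homOfObjEquiv hZ _ _ (φ ≫ g))
  -- The pullback of an identity along `Z ⟶ B` is a copy of `Z`.
  have hz : IsZero (F.obj (Pt.idPt B)).pt := by
    refine (IsZero.iff_id_eq_zero _).2 (pullback.hom_ext ?_ (hZ.eq_of_tgt _ _))
    have := pullback.condition (f := (Pt.idPt B).proj) (g := (0 : Z ⟶ B))
    simp only [Pt.idPt, Category.comp_id, comp_zero] at this
    exact (Category.id_comp _).trans (this.trans zero_comp.symm)
  have h0 : φ ≫ g = 0 := by
    refine (congrArg Pt.Hom.hom hh).symm.trans ?_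
    rw [Pt.comp_hom, hz.eq_zero_of_src h.hom, comp_zero]
    rfl
  rw [← Category.id_comp g, ← hψφ, Category.assoc, h0, comp_zero]

end PeriAbelian

theorem mainTheorem6 {C : Type u} [Category.{v} C] [HasZeroMorphisms C]
    [PeriAbelian.SemiAbelian C] (hPA : PeriAbelian.IsPeriAbelian C) (B P : C)
    (hP : PeriAbelian.IsPerfect P) : PeriAbelian.IsPerfect (PeriAbelian.bemol B P) := by
  exact PeriAbelian.isPerfect_bemol hPA B hP
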